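/- All graphs are finite and simple. For a graph $G$, the distinguishing number $D(G)$ is the least integer $r$ such that there is a vertex labeling $\phi : V(G) \to \{1,\dots,r\}$ that is preserved by no non-trivial automorphism of $G$. For graphs $G_1, G_2$ the neighbourhood corona $G_1 \star G_2$ is obtained from one copy of $G_1$ and $|V(G_1)|$ copies of $G_2$, one for each vertex of $G_1$, by joining, for every vertex $v$ of $G_1$, all neighbours of $v$ in $G_1$ to every vertex of the copy of $G_2$ that belongs to $v$. The friendship graph $F_n$ consists of $n$ triangles sharing one common vertex, and $K_1$ is the one-vertex graph. Theorem. For every $\varepsilon > 0$ there is a connected graph $G$ of order greater than $1$ with $$\frac{D(G \star K_1)}{D(G)} < \varepsilon .$$ In particular, $$\lim_{n \to \infty} \frac{D(F_n \star K_1)}{D(F_n)} = 0 .$$ -/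

import Mathlib

namespace SimpleGraph

/-- A vertex labeling is distinguishing if the identity is the only automorphism of `G`
that preserves all labels. -/
def IsDistinguishing {V : Type*} {α : Type*} (G : SimpleGraph V) (φ : V → α) : Prop :=
  ∀ σ : G ≃g G, (∀ x, φ (σ x) = φ x) → ∀ x, σ x = x

/-- The distinguishing number `D(G)`: the least `r` such that `G` has a distinguishing
vertex labeling with `r` labels. -/
noncomputable def distinguishingNumber {V : Type*} (G : SimpleGraph V) : ℕ :=
  sInf {r : ℕ | ∃ φ : V → Fin r, G.IsDistinguishing φ}

/-- For a finite graph the minimum defining `D(G)` is attained. -/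
theorem exists_isDistinguishing_distinguishingNumber {V : Type*} [Fintype V]
    (G : SimpleGraph V) : ∃ φ : V → Fin G.distinguishingNumber, G.IsDistinguishing φ := by
  have h : {r : ℕ | ∃ φ : V → Fin r, G.IsDistinguishing φ}.Nonempty :=
    ⟨Fintype.card V, Fintype.equivFin V, fun σ h x => (Fintype.equivFin V).injective (h x)⟩
  exact Nat.sInf_mem h

/-- `D(G)` is positive for a finite nonempty graph. -/
theorem distinguishingNumber_pos {V : Type*} [Fintype V] [Nonempty V]
    (G : SimpleGraph V) : 0 < G.distinguishingNumber := by
  obtain ⟨φ, -⟩ := G.exists_isDistinguishing_distinguishingNumber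
  exact Fin.pos (φ (Classical.arbitrary V))

/-- The neighbourhood corona `G ⋆ H`: one copy of `G` (the vertices `Sum.inl v`) and one copy of
`H` for each vertex `v` of `G` (the vertices `Sum.inr (v, w)`), where every vertex of the copy
of `H` that belongs to `v` is joined to all neighbours of `v` in `G`. -/
def neighbourhoodCorona {V W : Type*} (G : SimpleGraph V) (H : SimpleGraph W) :
    SimpleGraph (V ⊕ (V × W)) where
  Adj
    | Sum.inl u, Sum.inl v => G.Adj u v
    | Sum.inl u, Sum.inr (v, _) => G.Adj v u
    | Sum.inr (v, _), Sum.inl u => G.Adj v u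
    | Sum.inr (u, a), Sum.inr (v, b) => u = v ∧ H.Adj a b
  symm := ⟨by
    rintro (u | ⟨u, a⟩) (v | ⟨v, b⟩) h
    · exact G.adj_symm h
    · exact h
    · exact h
    · exact ⟨h.1.symm, H.adj_symm h.2⟩⟩
  loopless := ⟨by
    rintro (u | ⟨u, a⟩) h
    · exact G.irrefl h
    · exact H.irrefl h.2⟩

/-- The friendship graph `F_n`: `n` triangles sharing the common vertex `none`; the `i`-th
triangle has the vertices `none`, `some (i, 0)` and `some (i, 1)`. -/
def friendshipGraph (n : ℕ) : SimpleGraph (Option (Fin n × Fin 2)) where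
  Adj
    | none, none => False
    | none, some _ => True
    | some _, none => True
    | some (i, a), some (j, b) => i = j ∧ a ≠ b
  symm := ⟨by
    rintro (_ | ⟨i, a⟩) (_ | ⟨j, b⟩) h
    · exact h
    · exact h
    · exact h
    · exact ⟨h.1.symm, h.2.symm⟩⟩
  loopless := ⟨by
    rintro (_ | ⟨i, a⟩) h
    · exact h
    · exact h.2 rfl⟩

end SimpleGraph

/-!
The friendship graph `F_n` has many automorphisms: any permutation of its `n` triangles extends to
one. Hence in a distinguishing labeling the pairs of labels on the `n` outer edges are pairwise
distinct, which forces `n ≤ D(F_n) ^ 2`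
(`SimpleGraph.le_distinguishingNumber_friendshipGraph_sq`).

In `F_n ⋆ K_1` each triangle owns *four* outer vertices: its two original ones and their two
copies. A labeling that records the role of a vertex (one of six) reduces the automorphisms to be
excluded to permutations of the triangles, and `k` further labels on the four outer vertices
separate up to `k ^ 4` triangles. Hence `D(F_n ⋆ K_1) ≤ 6 k` as soon as `n ≤ k ^ 4`
(`SimpleGraph.distinguishingNumber_neighbourhoodCorona_friendshipGraph_le`).

So `D(F_n)` grows at least like `n ^ (1/2)` while `D(F_n ⋆ K_1)` grows at most like `n ^ (1/4)`, and
the quotient tends to `0`. The friendship graphs then also serve as examples for every `ε`.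
-/

namespace SimpleGraph

theorem IsDistinguishing.distinguishingNumber_le {V α : Type*} [Fintype α] {G : SimpleGraph V}
    {φ : V → α} (h : G.IsDistinguishing φ) : G.distinguishingNumber ≤ Fintype.card α :=
  Nat.sInf_le ⟨fun x => Fintype.equivFin α (φ x),
    fun σ hσ => h σ fun x => (Fintype.equivFin α).injective (hσ x)⟩

/-! ### The friendship graph -/

theorem connected_friendshipGraph (n : ℕ) : (friendshipGraph n).Connected := by
  have h : ∀ x, (friendshipGraph n).Reachable none x := by
    rintro (_ | x)
    · exact Reachable.refl _
    · exact Adj.reachable (show (friendshipGraph n).Adj none (some x) from trivial)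
  exact ⟨fun x y => (h x).symm.trans (h y)⟩

/-- The automorphism of `F_n` induced by a permutation of its triangles. -/
def friendshipGraphIso {n : ℕ} (e : Equiv.Perm (Fin n)) :
    friendshipGraph n ≃g friendshipGraph n where
  toEquiv := (Equiv.prodCongr e (Equiv.refl (Fin 2))).optionCongr
  map_rel_iff' := by
    rintro (_ | ⟨i, a⟩) (_ | ⟨j, b⟩) <;> simp [friendshipGraph]

/-- Two triangles with the same labels could be interchanged by a label-preserving
automorphism. -/
theorem IsDistinguishing.injective_friendshipGraph {n : ℕ} {α : Type*}
    {φ : Option (Fin n × Fin 2) → α} (h : (friendshipGraph n).IsDistinguishing φ) :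
    Function.Injective fun (i : Fin n) (a : Fin 2) => φ (some (i, a)) := by
  intro i j hij
  have key := h (friendshipGraphIso (Equiv.swap i j)) (by
    rintro (_ | ⟨l, a⟩)
    · rfl
    · have ha : φ (some (i, a)) = φ (some (j, a)) := congrFun hij a
      change φ (some (Equiv.swap i j l, a)) = φ (some (l, a))
      rcases eq_or_ne l i with rfl | hi
      · rw [Equiv.swap_apply_left, ha]
      rcases eq_or_ne l j with rfl | hj
      · rw [Equiv.swap_apply_right, ha]
      rw [Equiv.swap_apply_of_ne_of_ne hi hj]) (some (i, 0))
  have hs : (some (Equiv.swap i j i, (0 : Fin 2))) = some (i, 0) := key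
  simpa using hs.symm

theorem le_distinguishingNumber_friendshipGraph_sq (n : ℕ) :
    n ≤ (friendshipGraph n).distinguishingNumber ^ 2 := by
  obtain ⟨φ, hφ⟩ := (friendshipGraph n).exists_isDistinguishing_distinguishingNumber
  simpa using Fintype.card_le_of_injective _ hφ.injective_friendshipGraph

/-! ### The neighbourhood corona of the friendship graph with `K_1` -/

/-- The labeling of `F_n ⋆ K_1` determined by `f`. The first component of a label is the role of
the vertex: its place in its triangle (`none` for the centre) and whether it is an original vertex
(`0`) or a copy (`1`). The second component is the value of `f` for that triangle and role, and
`c` at the centre and its copy. -/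
def coronaLabeling {n : ℕ} {α : Type*} (c : α) (f : Fin n → Fin 2 × Fin 2 → α) :
    Option (Fin n × Fin 2) ⊕ (Option (Fin n × Fin 2) × Fin 1) → (Option (Fin 2) × Fin 2) × α
  | Sum.inl none => ((none, 0), c)
  | Sum.inl (some (i, a)) => ((some a, 0), f i (a, 0))
  | Sum.inr (none, _) => ((none, 1), c)
  | Sum.inr (some (i, a), _) => ((some a, 1), f i (a, 1))

theorem isDistinguishing_coronaLabeling {n : ℕ} {α : Type*} (c : α)
    {f : Fin n → Fin 2 × Fin 2 → α} (hf : Function.Injective f) :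
    ((friendshipGraph n).neighbourhoodCorona (⊤ : SimpleGraph (Fin 1))).IsDistinguishing
      (coronaLabeling c f) := by
  intro σ hσ
  have orig : ∀ i a, ∃ j, σ (Sum.inl (some (i, a))) = Sum.inl (some (j, a)) ∧
      f j (a, 0) = f i (a, 0) := by
    intro i a
    have h := hσ (Sum.inl (some (i, a)))
    rcases hx : σ (Sum.inl (some (i, a))) with (_ | ⟨j, b⟩) | ⟨_ | ⟨j, b⟩, t⟩ <;>
      simp [hx, coronaLabeling] at h
    obtain ⟨rfl, h⟩ := h
    exact ⟨j, rfl, h⟩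
  have copy : ∀ i a t, ∃ j, σ (Sum.inr (some (i, a), t)) = Sum.inr (some (j, a), t) ∧
      f j (a, 1) = f i (a, 1) := by
    intro i a t
    have h := hσ (Sum.inr (some (i, a), t))
    rcases hx : σ (Sum.inr (some (i, a), t)) with (_ | ⟨j, b⟩) | ⟨_ | ⟨j, b⟩, s⟩ <;>
      simp [hx, coronaLabeling] at h
    obtain ⟨rfl, h⟩ := h
    exact ⟨j, by rw [Subsingleton.elim s t], h⟩
  -- The edges between the two places of triangle `i` force its four outer vertices to be mapped
  -- into one triangle `j`; then `f j = f i`, so `j = i`.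
  have outer : ∀ i, (∀ a, σ (Sum.inl (some (i, a))) = Sum.inl (some (i, a))) ∧
      ∀ a t, σ (Sum.inr (some (i, a), t)) = Sum.inr (some (i, a), t) := by
    intro i
    obtain ⟨j, hj, fj⟩ := orig i 0
    obtain ⟨j₁, hj₁, fj₁⟩ := orig i 1
    obtain ⟨l, hl, fl⟩ := copy i 0 0
    obtain ⟨l₁, hl₁, fl₁⟩ := copy i 1 0
    have e₁ : j = j₁ := by
      have h := (σ.map_rel_iff (a := Sum.inl (some (i, 0))) (b := Sum.inl (some (i, 1)))).2
        (by simp [neighbourhoodCorona, friendshipGraph])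
      rw [hj, hj₁] at h
      exact h.1
    have e₂ : l₁ = j := by
      have h := (σ.map_rel_iff (a := Sum.inl (some (i, 0))) (b := Sum.inr (some (i, 1), 0))).2
        (by simp [neighbourhoodCorona, friendshipGraph])
      rw [hj, hl₁] at h
      exact h.1
    have e₃ : l = j₁ := by
      have h := (σ.map_rel_iff (a := Sum.inl (some (i, 1))) (b := Sum.inr (some (i, 0), 0))).2
        (by simp [neighbourhoodCorona, friendshipGraph])
      rw [hj₁, hl] at h
      exact h.1
    subst e₁ e₃ e₂
    have e : l₁ = i := hf (by
      funext ⟨a, b⟩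
      fin_cases a <;> fin_cases b <;> assumption)
    subst e
    refine ⟨fun a => ?_, fun a t => ?_⟩
    · fin_cases a <;> assumption
    · rw [Subsingleton.elim t 0]
      fin_cases a <;> assumption
  rintro ((_ | ⟨i, a⟩) | ⟨_ | ⟨i, a⟩, t⟩)
  · have h := hσ (Sum.inl none)
    rcases hx : σ (Sum.inl none) with (_ | ⟨j, b⟩) | ⟨_ | ⟨j, b⟩, t⟩ <;>
      simp [hx, coronaLabeling] at h
    rfl
  · exact (outer i).1 a
  · have h := hσ (Sum.inr (none, t))
    rcases hx : σ (Sum.inr (none, t)) with (_ | ⟨j, b⟩) | ⟨_ | ⟨j, b⟩, s⟩ <;>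
      simp [hx, coronaLabeling] at h
    rw [Subsingleton.elim s t]
  · exact (outer i).2 a t

theorem distinguishingNumber_neighbourhoodCorona_friendshipGraph_le {n k : ℕ} (hk : 0 < k)
    (h : n ≤ k ^ 4) :
    ((friendshipGraph n).neighbourhoodCorona (⊤ : SimpleGraph (Fin 1))).distinguishingNumber ≤
      6 * k := by
  obtain ⟨f⟩ : Nonempty (Fin n ↪ (Fin 2 × Fin 2 → Fin k)) :=
    Function.Embedding.nonempty_of_card_le (by simpa using h)
  simpa using
    (isDistinguishing_coronaLabeling (⟨0, hk⟩ : Fin k) f.injective).distinguishingNumber_le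

/-! ### The limit -/

theorem distinguishingNumber_ratio_friendshipGraph_le {n : ℕ} (hn : 0 < n) :
    (((friendshipGraph n).neighbourhoodCorona
        (⊤ : SimpleGraph (Fin 1))).distinguishingNumber : ℝ) /
      ((friendshipGraph n).distinguishingNumber : ℝ) ≤
      12 * ((n.sqrt.sqrt : ℕ) : ℝ)⁻¹ := by
  have hq : 0 < n.sqrt.sqrt := Nat.sqrt_pos.2 (Nat.sqrt_pos.2 hn)
  -- `k = n.sqrt.sqrt + 1` satisfies `n ≤ k ^ 4` and `k ≤ 2 * n.sqrt.sqrt`.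
  have hn4 : n ≤ (n.sqrt.sqrt + 1) ^ 4 :=
    calc n ≤ (n.sqrt + 1) ^ 2 := (Nat.lt_succ_sqrt' n).le
      _ ≤ ((n.sqrt.sqrt + 1) ^ 2) ^ 2 := Nat.pow_le_pow_left (Nat.lt_succ_sqrt' n.sqrt) 2
      _ = (n.sqrt.sqrt + 1) ^ 4 := by ring
  have hup : ((friendshipGraph n).neighbourhoodCorona
      (⊤ : SimpleGraph (Fin 1))).distinguishingNumber ≤ 12 * n.sqrt.sqrt :=
    (distinguishingNumber_neighbourhoodCorona_friendshipGraph_le (Nat.succ_pos _) hn4).trans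
      (by omega)
  have hlow : n.sqrt.sqrt ^ 2 ≤ (friendshipGraph n).distinguishingNumber := by
    refine (Nat.sqrt_le' n.sqrt).trans ((Nat.pow_le_pow_iff_left two_ne_zero).1 ?_)
    exact (Nat.sqrt_le' n).trans (le_distinguishingNumber_friendshipGraph_sq n)
  have hq' : (0 : ℝ) < n.sqrt.sqrt := by exact_mod_cast hq
  have hup' : (((friendshipGraph n).neighbourhoodCorona
      (⊤ : SimpleGraph (Fin 1))).distinguishingNumber : ℝ) ≤ 12 * n.sqrt.sqrt := by
    exact_mod_cast hup
  have hlow' : (n.sqrt.sqrt : ℝ) ^ 2 ≤ (friendshipGraph n).distinguishingNumber := by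
    exact_mod_cast hlow
  calc _ ≤ (12 * (n.sqrt.sqrt : ℝ)) / (n.sqrt.sqrt : ℝ) ^ 2 := by gcongr
    _ = 12 * (n.sqrt.sqrt : ℝ)⁻¹ := by field_simp

theorem tendsto_distinguishingNumber_ratio_friendshipGraph :
    Filter.Tendsto
      (fun n : ℕ =>
        (((friendshipGraph n).neighbourhoodCorona
            (⊤ : SimpleGraph (Fin 1))).distinguishingNumber : ℝ) /
          ((friendshipGraph n).distinguishingNumber : ℝ))
      Filter.atTop (nhds 0) := by
  have hsqrt : Filter.Tendsto Nat.sqrt Filter.atTop Filter.atTop :=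
    Filter.tendsto_atTop.2 fun b => by
      filter_upwards [Filter.eventually_ge_atTop (b ^ 2)] with n hn
      exact Nat.le_sqrt'.2 hn
  have hbound : Filter.Tendsto (fun n : ℕ => 12 * ((n.sqrt.sqrt : ℕ) : ℝ)⁻¹)
      Filter.atTop (nhds 0) := by
    have h := tendsto_inv_atTop_zero.comp
      (tendsto_natCast_atTop_atTop (R := ℝ) |>.comp (hsqrt.comp hsqrt))
    simpa using h.const_mul 12
  refine squeeze_zero' (Filter.Eventually.of_forall fun n => by positivity) ?_ hbound
  filter_upwards [Filter.eventually_gt_atTop 0] with n hn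
  exact distinguishingNumber_ratio_friendshipGraph_le hn

end SimpleGraph

theorem mainTheorem6 :
    (∀ ε : ℝ, 0 < ε → ∃ (V : Type) (_ : Fintype V) (G : SimpleGraph V),
      1 < Fintype.card V ∧ G.Connected ∧
        ((G.neighbourhoodCorona (⊤ : SimpleGraph (Fin 1))).distinguishingNumber : ℝ) /
          (G.distinguishingNumber : ℝ) < ε) ∧
    Filter.Tendsto
      (fun n : ℕ =>
        (((SimpleGraph.friendshipGraph n).neighbourhoodCorona
            (⊤ : SimpleGraph (Fin 1))).distinguishingNumber : ℝ) /
          ((SimpleGraph.friendshipGraph n).distinguishingNumber : ℝ))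
      Filter.atTop (nhds 0) := by
  have hlim := SimpleGraph.tendsto_distinguishingNumber_ratio_friendshipGraph
  refine ⟨fun ε hε => ?_, hlim⟩
  obtain ⟨n, hn, hpos⟩ :=
    ((hlim.eventually_lt_const hε).and (Filter.eventually_gt_atTop 0)).exists
  exact ⟨_, inferInstance, SimpleGraph.friendshipGraph n, by simp; omega,
    SimpleGraph.connected_friendshipGraph n, hn⟩
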